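/- Let $(R,\mathfrak m)$ be a commutative Noetherian local ring and let $n\ge 0$ be an integer. A finitely generated $R$-module $M$ is said to satisfy Serre's condition $(S_n)$ if $\operatorname{depth} M_{\mathfrak p}\ge \min(n,\dim M_{\mathfrak p})$ for every $\mathfrak p\in\operatorname{Supp} M$, where depth and dimension are taken over $R_{\mathfrak p}$; $R$ is said to satisfy $(S_n)$ if it does so as a module over itself. A nonzero finitely generated $R$-module $M$ is called perfect if its projective dimension is finite and equals $\operatorname{grade} M=\inf\{i\ge 0 : \operatorname{Ext}^i_R(M,R)\neq 0\}$. If $R$ satisfies $(S_n)$, then every perfect $R$-module of projective dimension $t\le n$ satisfies $(S_{n-t})$. -/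

import Mathlib

open CategoryTheory CategoryTheory.Abelian

universe u

noncomputable section

/-- The depth of a module `M` over a local ring `(R, 𝔪)`: the supremum of the lengths of the
`M`-regular sequences contained in `𝔪`. For finitely generated `M ≠ 0` the requirement
`M ≠ (x₁, …, xᵣ) M` on a regular sequence in `𝔪` is automatic by Nakayama's lemma, so that
it suffices to speak of weakly regular sequences; the depth of the zero module is then `∞`. -/
def moduleDepth (R : Type*) [CommRing R] [IsLocalRing R]
    (M : Type*) [AddCommGroup M] [Module R M] : ℕ∞ :=
  ⨆ (rs : List R) (_ : ∀ r ∈ rs, r ∈ IsLocalRing.maximalIdeal R)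
    (_ : RingTheory.Sequence.IsWeaklyRegular M rs), (rs.length : ℕ∞)

/-- The grade of the pair `(M, N)`: the least `i ≥ 0` such that `Extⁱ_R(M, N) ≠ 0`
(and `∞` if there is none). -/
def moduleGrade (R : Type u) [CommRing R] (M N : Type u) [AddCommGroup M] [Module R M]
    [AddCommGroup N] [Module R N] : ℕ∞ :=
  ⨅ (i : ℕ) (_ : Nontrivial (Ext.{u} (ModuleCat.of R M) (ModuleCat.of R N) i)), (i : ℕ∞)

/-- A finitely generated module `M` over `R` is perfect if its projective dimension is finite
and equal to `grade M = grade (M, R)`. -/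
structure IsPerfectModule (R : Type u) [CommRing R] (M : Type u) [AddCommGroup M]
    [Module R M] : Prop where
  finite : Module.Finite R M
  projectiveDimension_ne_top : projectiveDimension (ModuleCat.of R M) ≠ ⊤
  projectiveDimension_eq_grade :
    projectiveDimension (ModuleCat.of R M) = ((moduleGrade R M R : ℕ∞) : WithBot ℕ∞)

/-- Serre's condition `(Sₙ)` for an `R`-module `M`:
`depth M_𝔭 ≥ min (n, dim M_𝔭)` for all `𝔭 ∈ Supp M`, where depth and dimension
of `M_𝔭` are taken over the local ring `R_𝔭`. -/
def SatisfiesSerre (R : Type*) [CommRing R] (M : Type*) [AddCommGroup M] [Module R M]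
    (n : ℕ) : Prop :=
  ∀ p ∈ Module.support R M,
    min (n : WithBot ℕ∞)
        (Module.supportDim (Localization.AtPrime p.asIdeal)
          (LocalizedModule p.asIdeal.primeCompl M)) ≤
      ((moduleDepth (Localization.AtPrime p.asIdeal)
          (LocalizedModule p.asIdeal.primeCompl M) : ℕ∞) : WithBot ℕ∞)

end

/-! Grade `t` puts an `R`-regular sequence of length `t` inside `Ann M`. It stays weakly regular in
`R_p`, so `dim M_p + t ≤ dim R_p`. Since `pd M_p ≤ t`, one half of Auslander–Buchsbaum gives `depth
M_p ≥ depth R_p - t ≥ min(n, dim R_p) - t ≥ min(n - t, dim M_p)`. That half follows by dimension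
shifting in `Ext(k, -)` along syzygies, together with Rees's characterisation of depth by vanishing
of `Ext`. Perfection of `M_p` is never needed. -/

open IsLocalRing RingTheory.Sequence in
/-- If the local ring `R` has a weakly regular sequence of length `d` in its maximal ideal and `M`
has projective dimension at most `t`, then `Extⁱ(k, M) = 0` for the residue field `k` and
`i + t < d`. -/
theorem subsingleton_ext_residue_of_hasProjectiveDimensionLE {R : Type u} [CommRing R]
    [IsLocalRing R] [IsNoetherianRing R] {rs : List R} (hmem : ∀ r ∈ rs, r ∈ maximalIdeal R)
    (hreg : IsWeaklyRegular R rs) (t : ℕ) (M : ModuleCat.{u} R) [Module.Finite R M]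
    [HasProjectiveDimensionLE M t] (i : ℕ) (hi : i + t < rs.length) :
    Subsingleton (Ext (ModuleCat.of R (R ⧸ maximalIdeal R)) M i) := by
  -- Flat base change preserves weak regularity, so `rs` yields the vanishing for `F` by Rees.
  have key (F : ModuleCat.{u} R) [Module.Finite R F] [Module.Flat R F] (j : ℕ)
      (hj : j < rs.length) :
      Subsingleton (Ext (ModuleCat.of R (R ⧸ maximalIdeal R)) F j) := by
    rcases subsingleton_or_nontrivial F with hF | hF
    · have hz := ModuleCat.isZero_of_subsingleton F
      refine ⟨fun a b ↦ ?_⟩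
      rw [← Ext.comp_mk₀_id a, ← Ext.comp_mk₀_id b, hz.eq_of_src (𝟙 F) 0]
      simp
    · have hw : IsWeaklyRegular F rs :=
        ((TensorProduct.rid R F).isWeaklyRegular_congr rs).mp
          (hreg.isWeaklyRegular_lTensor (M₂ := F))
      have hr := IsRegular.of_isWeaklyRegular_of_mem_maximalIdeal F hmem hw
      refine ModuleCat.subsingleton_ext_of_exists_isRegular (maximalIdeal R)
        (ModuleCat.of R (R ⧸ maximalIdeal R)) ?_ F ?_ rs hmem hr j hj
      · rw [Module.support_eq_zeroLocus, Ideal.annihilator_quotient]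
      · exact (Submodule.top_ne_ideal_smul_of_le_jacobson_annihilator
          (maximalIdeal_le_jacobson _)).symm.lt_top
  induction t generalizing M i with
  | zero =>
    have hp : HasProjectiveDimensionLT M 1 := ‹HasProjectiveDimensionLE M 0›
    rw [← projective_iff_hasProjectiveDimensionLT_one, ← IsProjective.iff_projective] at hp
    exact key M i hi
  | succ t ih =>
    obtain ⟨F, _, _, _, _, f, hf⟩ := Module.exists_finite_presentation R M
    have hS := LinearMap.shortExact_shortComplexKer hf
    -- `Extⁱ(k, M)` is squeezed between `Extⁱ(k, F)` and `Extⁱ⁺¹(k, ker f)`, and the syzygy `ker f`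
    -- has projective dimension one less, so `i + t` is unchanged.
    have : HasProjectiveDimensionLE f.shortComplexKer.X₁ t :=
      (hS.hasProjectiveDimensionLT_X₃_iff t inferInstance).mp ‹_›
    have h1 := ih f.shortComplexKer.X₁ (i + 1) (by omega)
    have h2 := key f.shortComplexKer.X₂ i (by omega)
    refine ⟨fun a b ↦ ?_⟩
    obtain ⟨a', rfl⟩ := Ext.covariant_sequence_exact₃ _ hS a rfl (Subsingleton.elim _ _)
    obtain ⟨b', rfl⟩ := Ext.covariant_sequence_exact₃ _ hS b rfl (Subsingleton.elim _ _)
    rw [Subsingleton.elim a' b']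

open IsLocalRing RingTheory.Sequence in
/-- The inequality `depth R - pd M ≤ depth M` in the Auslander–Buchsbaum formula. -/
theorem length_sub_le_moduleDepth_of_hasProjectiveDimensionLE {R : Type u} [CommRing R]
    [IsLocalRing R] [IsNoetherianRing R] {rs : List R} (hmem : ∀ r ∈ rs, r ∈ maximalIdeal R)
    (hreg : IsWeaklyRegular R rs) (t : ℕ) (M : Type u) [AddCommGroup M] [Module R M]
    [Module.Finite R M] [Nontrivial M] [HasProjectiveDimensionLE (ModuleCat.of R M) t] :
    ((rs.length - t : ℕ) : ℕ∞) ≤ moduleDepth R M := by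
  obtain ⟨xs, hlen, hxs, hxreg⟩ := ModuleCat.exists_isRegular_of_exists_subsingleton_ext
    (maximalIdeal R) (rs.length - t) (ModuleCat.of R M)
    (Submodule.top_ne_ideal_smul_of_le_jacobson_annihilator
          (maximalIdeal_le_jacobson _)).symm.lt_top
    (ModuleCat.of R (R ⧸ maximalIdeal R))
    (by rw [Module.support_eq_zeroLocus, Ideal.annihilator_quotient])
    fun i hi ↦ subsingleton_ext_residue_of_hasProjectiveDimensionLE hmem hreg t _ i (by omega)
  rw [← hlen]
  exact le_iSup₂_of_le xs hxs (le_iSup_of_le hxreg.toIsWeaklyRegular le_rfl)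

/-- A lower bound on the depth is witnessed by a weakly regular sequence. -/
theorem exists_isWeaklyRegular_of_le_moduleDepth {R : Type*} [CommRing R] [IsLocalRing R]
    {M : Type*} [AddCommGroup M] [Module R M] {m : ℕ} (h : (m : ℕ∞) ≤ moduleDepth R M) :
    ∃ rs : List R, (∀ r ∈ rs, r ∈ IsLocalRing.maximalIdeal R) ∧
      RingTheory.Sequence.IsWeaklyRegular M rs ∧ m ≤ rs.length := by
  rcases m with _ | m
  · exact ⟨[], by simp, .nil R M, le_rfl⟩
  -- The supremum may be infinite and unattained; a strict bound by the predecessor still produces a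
  -- witness.
  · have h' : (m : ℕ∞) < moduleDepth R M :=
      lt_of_lt_of_le (by exact_mod_cast m.lt_succ_self) h
    simp only [moduleDepth, lt_iSup_iff] at h'
    obtain ⟨rs, h1, h2, h3⟩ := h'
    exact ⟨rs, h1, h2, by exact_mod_cast h3⟩

open IsLocalRing RingTheory.Sequence in
/-- A module annihilated by a regular sequence of length `t` has codimension at least `t`. -/
theorem supportDim_add_length_le_ringKrullDim {R : Type*} [CommRing R] [IsLocalRing R]
    [IsNoetherianRing R] {xs : List R} (hreg : IsRegular R xs) (M : Type*) [AddCommGroup M]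
    [Module R M] [Module.Finite R M] (hann : ∀ x ∈ xs, x ∈ Module.annihilator R M) :
    Module.supportDim R M + xs.length ≤ ringKrullDim R := by
  rw [← ringKrullDim_add_length_eq_ringKrullDim_of_isRegular xs hreg,
    ← Module.supportDim_quotient_eq_ringKrullDim]
  gcongr
  have hsub : Module.support R M ⊆ Module.support R (R ⧸ Ideal.ofList xs) := by
    rw [Module.support_eq_zeroLocus, Module.support_eq_zeroLocus, Ideal.annihilator_quotient]
    exact PrimeSpectrum.zeroLocus_anti_mono (Ideal.span_le.mpr hann)
  exact Order.krullDim_le_of_strictMono (fun a ↦ ⟨a.1, hsub a.2⟩) fun {_ _} lt ↦ lt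

theorem exists_eq_natCast_of_ne_bot_of_ne_top {x : WithBot ℕ∞} (hb : x ≠ ⊥) (ht : x ≠ ⊤) :
    ∃ n : ℕ, x = n := by
  lift x to ℕ∞ using hb
  lift x to ℕ using fun h ↦ ht (by rw [h]; rfl)
  exact ⟨x, rfl⟩

open IsLocalRing RingTheory.Sequence in
/-- The local form of the inequality of Serre's condition for a module of projective dimension at
most `t` annihilated by a regular sequence of length `t`. -/
theorem min_supportDim_le_moduleDepth_of_isWeaklyRegular {R : Type u} [CommRing R]
    [IsLocalRing R] [IsNoetherianRing R] {n t : ℕ}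
    (hR : min (n : WithBot ℕ∞) (ringKrullDim R) ≤ ((moduleDepth R R : ℕ∞) : WithBot ℕ∞))
    (M : Type u) [AddCommGroup M] [Module R M] [Module.Finite R M] [Nontrivial M]
    [HasProjectiveDimensionLE (ModuleCat.of R M) t] {xs : List R} (hlen : xs.length = t)
    (hreg : IsWeaklyRegular R xs) (hann : ∀ x ∈ xs, x ∈ Module.annihilator R M) :
    min ((n - t : ℕ) : WithBot ℕ∞) (Module.supportDim R M) ≤
      ((moduleDepth R M : ℕ∞) : WithBot ℕ∞) := by
  have hmem : ∀ x ∈ xs, x ∈ maximalIdeal R := fun x hx ↦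
    le_maximalIdeal (by simpa [Module.annihilator_eq_top_iff, not_subsingleton_iff_nontrivial])
      (hann x hx)
  have hdim := supportDim_add_length_le_ringKrullDim
    (IsRegular.of_isWeaklyRegular_of_mem_maximalIdeal R hmem hreg) M hann
  obtain ⟨d, hd⟩ : ∃ d : ℕ, ringKrullDim R = d :=
    exists_eq_natCast_of_ne_bot_of_ne_top ringKrullDim_ne_bot ringKrullDim_ne_top
  obtain ⟨e, he⟩ : ∃ e : ℕ, Module.supportDim R M = e :=
    exists_eq_natCast_of_ne_bot_of_ne_top (Module.supportDim_ne_bot_of_nontrivial R M)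
      ((Module.supportDim_le_ringKrullDim R M).trans_lt ringKrullDim_lt_top).ne
  rw [hd] at hR hdim
  rw [he, hlen] at hdim
  rw [he]
  have hR' : ((min n d : ℕ) : ℕ∞) ≤ moduleDepth R R  := by
    rw [← Nat.mono_cast.map_min] at hR
    exact_mod_cast hR
  obtain ⟨rs, h1, h2, h3⟩ := exists_isWeaklyRegular_of_le_moduleDepth hR'
  have h4 := length_sub_le_moduleDepth_of_hasProjectiveDimensionLE h1 h2 t M
  have h5 : e + t ≤ d := by exact_mod_cast hdim
  have h6 : ((min (n - t) e : ℕ) : ℕ∞) ≤ moduleDepth R M :=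
    le_trans (by exact_mod_cast (by omega : min (n - t) e ≤ rs.length - t)) h4
  rw [← Nat.mono_cast.map_min]
  exact_mod_cast h6

open RingTheory.Sequence in
/-- The annihilator of a module of grade at least `t` contains a regular sequence of length
`t`. -/
theorem exists_isWeaklyRegular_mem_annihilator_of_le_moduleGrade {R : Type u} [CommRing R]
    [IsNoetherianRing R] (M : Type u) [AddCommGroup M] [Module R M] [Module.Finite R M]
    [Nontrivial M] {t : ℕ} (h : (t : ℕ∞) ≤ moduleGrade R M R) :
    ∃ xs : List R, xs.length = t ∧ (∀ x ∈ xs, x ∈ Module.annihilator R M) ∧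
      IsWeaklyRegular R xs := by
  -- Rees's theorem for the ideal `Ann M`, tested on `M` itself because `Supp M = V(Ann M)`.
  obtain ⟨xs, h1, h2, h3⟩ := ModuleCat.exists_isRegular_of_exists_subsingleton_ext
    (Module.annihilator R M) t (ModuleCat.of R R)
    (by simpa [lt_top_iff_ne_top, Module.annihilator_eq_top_iff, not_subsingleton_iff_nontrivial])
    (ModuleCat.of R M) (Module.support_eq_zeroLocus ..) fun i hi ↦ by
      by_contra hne
      rw [not_subsingleton_iff_nontrivial] at hne
      have : (t : ℕ∞) ≤ i := h.trans (iInf₂_le i hne)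
      exact absurd (by exact_mod_cast this) (not_le.mpr hi)
  exact ⟨xs, h1, h2, h3.toIsWeaklyRegular⟩

/-- Localization does not increase the projective dimension. -/
theorem hasProjectiveDimensionLE_localizedModule {R : Type u} [CommRing R] (S : Submonoid R)
    (M : ModuleCat.{u} R) (t : ℕ) [HasProjectiveDimensionLE M t] :
    HasProjectiveDimensionLE (ModuleCat.of (Localization S) (LocalizedModule S M)) t :=
  have := M.localizedModule_hasProjectiveDimensionLE t S
  ModuleCat.hasProjectiveDimensionLE_of_linearEquiv.{u, u} (M := M.localizedModule S)
    (N := ModuleCat.of (Localization S) (LocalizedModule S M))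
    (LinearEquiv.extendScalarsOfIsLocalization S (Localization S)
      (IsLocalizedModule.linearEquiv S (M.localizedModuleMkLinearMap S)
        (LocalizedModule.mkLinearMap S M))) t

/-- If `R` satisfies `(Sₙ)`, then every perfect `R`-module of projective dimension `t ≤ n`
satisfies `(Sₙ₋ₜ)`. -/
theorem corollary2p2 (R : Type u) [CommRing R] [IsLocalRing R] [IsNoetherianRing R]
    (n : ℕ) (hR : SatisfiesSerre R R n)
    (M : Type u) [AddCommGroup M] [Module R M] [Module.Finite R M] [Nontrivial M]
    (hM : IsPerfectModule R M)
    (t : ℕ) (ht : projectiveDimension (ModuleCat.of R M) = (t : WithBot ℕ∞)) (htn : t ≤ n) :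
    SatisfiesSerre R M (n - t) := by
  intro p hp
  have hgrade : (t : ℕ∞) ≤ moduleGrade R M R := by
    have := ht.symm.trans hM.projectiveDimension_eq_grade
    exact_mod_cast this.le
  obtain ⟨xs, hlen, hann, hreg⟩ :=
    exists_isWeaklyRegular_mem_annihilator_of_le_moduleGrade M hgrade
  have : HasProjectiveDimensionLE (ModuleCat.of R M) t :=
    (projectiveDimension_le_iff _ _).mp ht.le
  have : HasProjectiveDimensionLE (ModuleCat.of (Localization.AtPrime p.asIdeal)
      (LocalizedModule p.asIdeal.primeCompl M)) t :=
    hasProjectiveDimensionLE_localizedModule p.asIdeal.primeCompl (ModuleCat.of R M) t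
  have : Nontrivial (LocalizedModule p.asIdeal.primeCompl M) := hp
  refine min_supportDim_le_moduleDepth_of_isWeaklyRegular ?_ _
    (xs := xs.map (algebraMap R (Localization.AtPrime p.asIdeal))) (by simpa using hlen)
    (hreg.of_isLocalization _ p.asIdeal.primeCompl) ?_
  -- Every prime lies in `Supp R`, so the hypothesis on `R` applies at `p`.
  · rw [← Module.supportDim_self_eq_ringKrullDim]
    exact hR p (by
      simp [Module.support_eq_zeroLocus, Module.annihilator_eq_bot.mpr (inferInstance :
        FaithfulSMul R R)])
  · intro y hy
    obtain ⟨x, hx, rfl⟩ := List.mem_map.mp hy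
    rw [Module.mem_annihilator]
    intro m
    induction m using LocalizedModule.induction_on with
    | h m s =>
      rw [algebraMap_smul, LocalizedModule.smul'_mk,
        Module.mem_annihilator.mp (hann x hx), LocalizedModule.zero_mk]
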